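/- **Setting.** Let $\mathcal C$ be a bicategory and $W$ a class of $1$-morphisms of $\mathcal C$ such that $(\mathcal C,W)$ admits a right bicalculus of fractions (associators and unitors of $\mathcal C$ are suppressed throughout): * (BF1) $\mathrm{id}_A\in W$ for every object $A$; (BF2) $W$ is closed under composition; * (BF3) for every $\mathrm v:B'\to B$ in $W$ and every $f:A'\to B$ there are $\mathrm v':A''\to A'$ in $W$, $f':A''\to B'$ and an invertible $\rho:f\circ \mathrm v'\Rightarrow \mathrm v\circ f'$; * (BF4) for every $\mathrm w:B\to A$ in $W$, $f^1,f^2:X\to B$ and $\alpha:\mathrm w\circ f^1\Rightarrow \mathrm w\circ f^2$ there are $\mathrm v:D\to X$ in $W$ and $\beta:f^1\circ \mathrm v\Rightarrow f^2\circ \mathrm v$ with $\alpha\circ \mathrm v=\mathrm w\circ\beta$, where $\beta$ can be taken invertible if $\alpha$ is invertible; and for any two such triples $(D,\mathrm v,\beta)$, $(D',\mathrm v',\beta')$ there are $\mathrm u:E\to D$, $\mathrm u':E\to D'$ and an invertible $\zeta:\mathrm v\circ \mathrm u\Rightarrow \mathrm v'\circ \mathrm u'$ with $\mathrm v\circ \mathrm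 u\in W$ and $(\beta'\circ \mathrm u')\cdot(f^1\circ\zeta)=(f^2\circ\zeta)\cdot(\beta\circ \mathrm u)$; * (BF5) if $\mathrm w\in W$ and $\mathrm v\Rightarrow \mathrm w$ is an invertible $2$-morphism, then $\mathrm v\in W$. Fix a set of choices $C(W)$: for every pair $(f,\mathrm v)$ as in (BF3), a choice of $(A'',\mathrm v',f',\rho)$. A set of choices $D(W)$ consists, for every $(\mathrm w,f^1,f^2,\alpha)$ as in (BF4), of a choice of $(D,\mathrm v,\beta)$ as there, with $\beta$ invertible whenever $\alpha$ is. In the bicategory of fractions $\mathcal C[W^{-1}]$ a $1$-morphism $A\to B$ is a triple $(A',\mathrm w,f)$ with $\mathrm w:A'\to A$ in $W$ and $f:A'\to B$. The composite of $(A',\mathrm w,f):A\to B$ and $(B',\mathrm v,g):B\to Z$ is $(A'',\mathrm w\circ \mathrm v',g\circ f')$, where $(A'',\mathrm v',f',\rho)$ is chosen by $C(W)$ for $(f,\mathrm v)$. A $2$-morphism $(A^1,\mathrm w^1,f^1)\Rightarrow(A^2,\mathrm w^2,f^2)$ is a class of data $(A^3,\mathrm v^1,\mathrm v^2,\alpha,\beta)$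 with $\mathrm v^m:A^3\to A^m$, $\mathrm w^1\circ \mathrm v^1\in W$, $\alpha:\mathrm w^1\circ \mathrm v^1\Rightarrow \mathrm w^2\circ \mathrm v^2$ invertible and $\beta:f^1\circ \mathrm v^1\Rightarrow f^2\circ \mathrm v^2$; such data are equivalent to $(A'^3,\mathrm v'^1,\mathrm v'^2,\alpha',\beta')$ if there are $\mathrm z:A^4\to A^3$, $\mathrm z':A^4\to A'^3$ and invertible $\sigma^1:\mathrm v'^1\circ \mathrm z'\Rightarrow \mathrm v^1\circ \mathrm z$, $\sigma^2:\mathrm v^2\circ \mathrm z\Rightarrow \mathrm v'^2\circ \mathrm z'$ with $\mathrm w^1\circ \mathrm v^1\circ \mathrm z\in W$, $(\mathrm w^2\circ\sigma^2)\cdot(\alpha\circ \mathrm z)\cdot(\mathrm w^1\circ\sigma^1)=\alpha'\circ \mathrm z'$ and $(f^2\circ\sigma^2)\cdot(\beta\circ \mathrm z)\cdot(f^1\circ\sigma^1)=\beta'\circ \mathrm z'$. **Definition of $\Delta\circ\underline f$.** Let $\underline f=(A',\mathrm w,f):A\to B$, $\underline g^m=(B^m,\mathrm v^m,g^m):B\to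 Z$ for $m=1,2$, and $\Delta:\underline g^1\Rightarrow\underline g^2$. Let $(D^m,\mathrm w^m,f^m,\rho^m)$ be chosen by $C(W)$ for $(f,\mathrm v^m)$, so $\underline g^m\circ\underline f=(D^m,\mathrm w\circ \mathrm w^m,g^m\circ f^m)$. Pronk's composite $\Delta\circ\underline f$, relative to $C(W)$ and $D(W)$, is obtained as follows from a representative $(B^3,\mathrm u^1,\mathrm u^2,\alpha,\beta)$ of $\Delta$. For $m=1,2$ let $C(W)$ choose $(R^m,\mathrm k^m,\tilde h^m,\tau^m)$ for $(f,\mathrm v^m\circ \mathrm u^m)$ and then $(\bar R^m,\mathrm a^m,\mathrm b^m,\lambda^m)$ for $(\mathrm k^m,\mathrm w^m)$, and let $D(W)$ choose, for $\mathrm v^m$ and the pasting of $(\rho^m)^{-1},(\lambda^m)^{-1},\tau^m$ from $\mathrm v^m\circ f^m\circ \mathrm b^m$ to $\mathrm v^m\circ \mathrm u^m\circ\tilde h^m\circ \mathrm a^m$, a morphism $\mathrm c^m$ in $W$ and an invertible $\sigma^m:f^m\circ \mathrm t^m\Rightarrow \mathrm u^m\circ h^m$, where $\mathrm t^m:=\mathrm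 b^m\circ \mathrm c^m$ and $h^m:=\tilde h^m\circ \mathrm a^m\circ \mathrm c^m$. Let $C(W)$ choose $(R,\mathrm a,\mathrm b,\tilde\varphi)$ for $(\mathrm w^1\circ \mathrm t^1,\mathrm w^2\circ \mathrm t^2)$, and let $D(W)$ choose $(D^5,\mathrm c,\delta)$ for $\mathrm v^1\circ \mathrm u^1$ and the pasting of $(\sigma^1)^{-1},(\rho^1)^{-1},\tilde\varphi,\rho^2,\sigma^2,\alpha^{-1}$ from $\mathrm v^1\circ \mathrm u^1\circ h^1\circ \mathrm a$ to $\mathrm v^1\circ \mathrm u^1\circ h^2\circ \mathrm b$. Then $\Delta\circ\underline f$ is the class of $(D^5,\mathrm t^1\circ \mathrm t^3,\mathrm t^2\circ \mathrm t^4,\mathrm w\circ\varphi,\xi)$, with $\mathrm t^3:=\mathrm a\circ \mathrm c$, $\mathrm t^4:=\mathrm b\circ \mathrm c$, $\varphi:=\tilde\varphi\circ \mathrm c$ and $\xi$ the pasting of $\sigma^1,\delta,\beta,(\sigma^2)^{-1}$ displayed in (X) below. **Proposition.** In this situation, for any set of choices $D(W)$: 1. The class $\Delta\circ\underline f$ does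 not depend on the representative of $\Delta$ used to compute it. 2. Fix any representative $(B^3,\mathrm u^1,\mathrm u^2,\alpha,\beta)$ of $\Delta$ and any set of data as follows: * (F5) morphisms $\mathrm t^1:D^3\to D^1$ and $\mathrm t^2:D^4\to D^2$ in $W$, morphisms $h^1:D^3\to B^3$ and $h^2:D^4\to B^3$, and invertible $\sigma^m:f^m\circ \mathrm t^m\Rightarrow \mathrm u^m\circ h^m$ for $m=1,2$; * (F6) a morphism $\mathrm t^3:D^5\to D^3$ in $W$, a morphism $\mathrm t^4:D^5\to D^4$ and an invertible $\varphi:\mathrm w^1\circ \mathrm t^1\circ \mathrm t^3\Rightarrow \mathrm w^2\circ \mathrm t^2\circ \mathrm t^4$; * (F7) an invertible $\delta:h^1\circ \mathrm t^3\Rightarrow h^2\circ \mathrm t^4$ such that $\mathrm v^1\circ \mathrm u^1\circ\delta$ equals $$(\alpha^{-1}\circ h^2\circ \mathrm t^4)\cdot(\mathrm v^2\circ\sigma^2\circ \mathrm t^4)\cdot(\rho^2\circ \mathrm t^2\circ \mathrm t^4)\cdot(f\circ\varphi)\cdot((\rho^1)^{-1}\circ \mathrm t^1\circ \mathrm t^3)\cdot(\mathrm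 v^1\circ(\sigma^1)^{-1}\circ \mathrm t^3).$$ Then $\Delta\circ\underline f$ is represented by $(D^5,\ \mathrm t^1\circ \mathrm t^3,\ \mathrm t^2\circ \mathrm t^4,\ \mathrm w\circ\varphi,\ \xi)$, where $$\xi:=(g^2\circ(\sigma^2)^{-1}\circ \mathrm t^4)\cdot(\beta\circ h^2\circ \mathrm t^4)\cdot(g^1\circ \mathrm u^1\circ\delta)\cdot(g^1\circ\sigma^1\circ \mathrm t^3).\tag{X}$$ 3. Given any other representative of $\Delta$ and any other data (F5)–(F7) for it, the diagram induced by the new data is equivalent to the one in 2. 4. Consequently $\Delta\circ\underline f$ is the same for all sets of choices $D(W)$ (with $C(W)$ fixed). -/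

import Mathlib

open CategoryTheory Bicategory

universe w v u

namespace BicategoryOfFractions

/-! Conventions: Mathlib writes composition of 1-morphisms in diagrammatic order, so the
composite "first `f`, then `g`" (classically `g ∘ f`) is `f ≫ g`; the classical `g ∘ η` is `η ▷ g`
and the classical `η ∘ f` is `f ◁ η`. The symbol `⊗≫` (and `≪⊗≫` for isomorphisms) is composition
of 2-morphisms up to the canonical associators and unitors. -/

section Axioms

variable {C : Type u} [Bicategory.{w, v} C]

/-- A square over the cospan `f : A' ⟶ B ⟵ B' : v`, filled by an invertible 2-morphism, whose side
opposite to `v` belongs to `W`. -/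
structure Filler (W : MorphismProperty C) {A' B B' : C} (f : A' ⟶ B) (v : B' ⟶ B) where
  apex : C
  v' : apex ⟶ A'
  f' : apex ⟶ B'
  mem : W v'
  ρ : v' ≫ f ≅ f' ≫ v

/-- A morphism `v` of `W` and a 2-morphism `β` such that `α ∘ v = w ∘ β`. -/
structure Lift (W : MorphismProperty C) {X B A : C} (w : B ⟶ A) (f₁ f₂ : X ⟶ B)
    (α : f₁ ≫ w ⟶ f₂ ≫ w) where
  apex : C
  v : apex ⟶ X
  mem : W v
  β : v ≫ f₁ ⟶ v ≫ f₂
  eq : v ◁ α = (α_ v f₁ w).inv ≫ β ▷ w ≫ (α_ v f₂ w).hom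

/-- The pair `(C, W)` admits a right bicalculus of fractions: axioms (BF1) to (BF5). -/
class AdmitsBicalculus (W : MorphismProperty C) : Prop where
  bf1 : ∀ A : C, W (𝟙 A)
  bf2 : ∀ {X Y Z : C} (f : X ⟶ Y) (g : Y ⟶ Z), W f → W g → W (f ≫ g)
  bf3 : ∀ {A' B B' : C} (f : A' ⟶ B) (v : B' ⟶ B), W v → Nonempty (Filler W f v)
  bf4ab : ∀ {X B A : C} (w : B ⟶ A), W w → ∀ (f₁ f₂ : X ⟶ B) (α : f₁ ≫ w ⟶ f₂ ≫ w),
    ∃ L : Lift W w f₁ f₂ α, IsIso α → IsIso L.β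
  bf4c : ∀ {X B A : C} (w : B ⟶ A), W w → ∀ (f₁ f₂ : X ⟶ B) (α : f₁ ≫ w ⟶ f₂ ≫ w)
    (L L' : Lift W w f₁ f₂ α),
    ∃ (E : C) (u : E ⟶ L.apex) (u' : E ⟶ L'.apex) (ζ : u ≫ L.v ≅ u' ≫ L'.v),
      W (u ≫ L.v) ∧
      ζ.hom ▷ f₁ ≫ (α_ u' L'.v f₁).hom ≫ u' ◁ L'.β =
        (α_ u L.v f₁).hom ≫ u ◁ L.β ≫ (α_ u L.v f₂).inv ≫ ζ.hom ▷ f₂ ≫ (α_ u' L'.v f₂).hom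
  bf5 : ∀ {X Y : C} (v w : X ⟶ Y), W w → (v ≅ w) → W v

/-- A set of choices `C(W)`: a filler for every cospan with right leg in `W`. -/
structure ChoicesC (W : MorphismProperty C) where
  fill : ∀ {A' B B' : C} (f : A' ⟶ B) (v : B' ⟶ B), W v → Filler W f v

/-- A set of choices `D(W)`: a lift, as provided by (BF4a) and (BF4b), for every
`α : w ∘ f₁ ⟹ w ∘ f₂` with `w` in `W`; it is invertible whenever `α` is. -/
structure ChoicesD (W : MorphismProperty C) where
  lift : ∀ {X B A : C} (w : B ⟶ A), W w → ∀ (f₁ f₂ : X ⟶ B) (α : f₁ ≫ w ⟶ f₂ ≫ w),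
    Lift W w f₁ f₂ α
  isIso : ∀ {X B A : C} (w : B ⟶ A) (hw : W w) (f₁ f₂ : X ⟶ B) (α : f₁ ≫ w ⟶ f₂ ≫ w),
    IsIso α → IsIso (lift w hw f₁ f₂ α).β

/-- The invertible lift chosen for an invertible 2-morphism. -/
noncomputable def ChoicesD.liftIso {W : MorphismProperty C} (cD : ChoicesD W) {X B A : C}
    (w : B ⟶ A) (hw : W w) (f₁ f₂ : X ⟶ B) (α : f₁ ≫ w ≅ f₂ ≫ w) :
    (cD.lift w hw f₁ f₂ α.hom).v ≫ f₁ ≅ (cD.lift w hw f₁ f₂ α.hom).v ≫ f₂ :=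
  @asIso _ _ _ _ (cD.lift w hw f₁ f₂ α.hom).β (cD.isIso w hw f₁ f₂ α.hom inferInstance)

/-- A 1-morphism `(A', w, f) : A ⟶ B` of the bicategory of fractions. -/
structure FracMor (W : MorphismProperty C) (A B : C) where
  apex : C
  w : apex ⟶ A
  mem : W w
  f : apex ⟶ B

/-- Data `(A³, v¹, v², α, β)` representing a 2-morphism of the bicategory of fractions. -/
structure FracRep {W : MorphismProperty C} {A B : C} (s t : FracMor W A B) where
  apex : C
  v₁ : apex ⟶ s.apex
  v₂ : apex ⟶ t.apex
  mem : W (v₁ ≫ s.w)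
  α : v₁ ≫ s.w ≅ v₂ ≫ t.w
  β : v₁ ≫ s.f ⟶ v₂ ≫ t.f

/-- The relation "`r` and `r'` represent the same 2-morphism". -/
def FracRep.Rel {W : MorphismProperty C} {A B : C} {s t : FracMor W A B} (r r' : FracRep s t) : Prop :=
  ∃ (E : C) (z : E ⟶ r.apex) (z' : E ⟶ r'.apex)
    (σ₁ : z' ≫ r'.v₁ ≅ z ≫ r.v₁) (σ₂ : z ≫ r.v₂ ≅ z' ≫ r'.v₂),
    W (z ≫ r.v₁ ≫ s.w) ∧
    σ₁.hom ▷ s.w ≫ (α_ z r.v₁ s.w).hom ≫ z ◁ r.α.hom ≫ (α_ z r.v₂ t.w).inv ≫ σ₂.hom ▷ t.w =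
      (α_ z' r'.v₁ s.w).hom ≫ z' ◁ r'.α.hom ≫ (α_ z' r'.v₂ t.w).inv ∧
    σ₁.hom ▷ s.f ≫ (α_ z r.v₁ s.f).hom ≫ z ◁ r.β ≫ (α_ z r.v₂ t.f).inv ≫ σ₂.hom ▷ t.f =
      (α_ z' r'.v₁ s.f).hom ≫ z' ◁ r'.β ≫ (α_ z' r'.v₂ t.f).inv

end Axioms

section Pasting

variable {C : Type u} [Bicategory.{w, v} C]
variable {A A' B B₁ B₂ B₃ D₁ D₂ D₃ D₄ D₅ Z : C} {p : A' ⟶ A} {f : A' ⟶ B}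
  {v₁ : B₁ ⟶ B} {v₂ : B₂ ⟶ B} {g₁ : B₁ ⟶ Z} {g₂ : B₂ ⟶ Z}
  {u₁ : B₃ ⟶ B₁} {u₂ : B₃ ⟶ B₂}
  {w₁ : D₁ ⟶ A'} {w₂ : D₂ ⟶ A'} {f₁ : D₁ ⟶ B₁} {f₂ : D₂ ⟶ B₂}
  {t₁ : D₃ ⟶ D₁} {t₂ : D₄ ⟶ D₂} {h₁ : D₃ ⟶ B₃} {h₂ : D₄ ⟶ B₃}
  {t₃ : D₅ ⟶ D₃} {t₄ : D₅ ⟶ D₄}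

/-- The pasting of `(σ¹)⁻¹`, `(ρ¹)⁻¹`, `φ`, `ρ²`, `σ²` and `α⁻¹`, from `v¹ ∘ u¹ ∘ h¹ ∘ t³` to
`v¹ ∘ u¹ ∘ h² ∘ t⁴`. -/
def zigzag (ρ₁ : w₁ ≫ f ≅ f₁ ≫ v₁) (ρ₂ : w₂ ≫ f ≅ f₂ ≫ v₂) (α : u₁ ≫ v₁ ≅ u₂ ≫ v₂)
    (σ₁ : t₁ ≫ f₁ ≅ h₁ ≫ u₁) (σ₂ : t₂ ≫ f₂ ≅ h₂ ≫ u₂)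
    (φ : t₃ ≫ t₁ ≫ w₁ ≅ t₄ ≫ t₂ ≫ w₂) :
    (t₃ ≫ h₁) ≫ u₁ ≫ v₁ ⟶ (t₄ ≫ h₂) ≫ u₁ ≫ v₁ :=
  𝟙 _ ⊗≫ t₃ ◁ σ₁.inv ▷ v₁ ⊗≫ (t₃ ≫ t₁) ◁ ρ₁.inv ⊗≫ φ.hom ▷ f ⊗≫
    (t₄ ≫ t₂) ◁ ρ₂.hom ⊗≫ t₄ ◁ σ₂.hom ▷ v₂ ⊗≫ (t₄ ≫ h₂) ◁ α.inv

/-- The pasting `ξ` of `σ¹`, `δ`, `β` and `(σ²)⁻¹`, from `(g¹ ∘ f¹) ∘ (t¹ ∘ t³)` to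
`(g² ∘ f²) ∘ (t² ∘ t⁴)`. -/
def xi (σ₁ : t₁ ≫ f₁ ≅ h₁ ≫ u₁) (σ₂ : t₂ ≫ f₂ ≅ h₂ ≫ u₂) (δ : t₃ ≫ h₁ ⟶ t₄ ≫ h₂)
    (β : u₁ ≫ g₁ ⟶ u₂ ≫ g₂) :
    (t₃ ≫ t₁) ≫ f₁ ≫ g₁ ⟶ (t₄ ≫ t₂) ≫ f₂ ≫ g₂ :=
  𝟙 _ ⊗≫ t₃ ◁ σ₁.hom ▷ g₁ ⊗≫ δ ▷ (u₁ ≫ g₁) ⊗≫ (t₄ ≫ h₂) ◁ β ⊗≫ t₄ ◁ σ₂.inv ▷ g₂ ⊗≫ 𝟙 _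

/-- The 2-morphism `p ∘ φ`, from `(p ∘ w¹) ∘ (t¹ ∘ t³)` to `(p ∘ w²) ∘ (t² ∘ t⁴)`. -/
def postcomp (p : A' ⟶ A) (φ : t₃ ≫ t₁ ≫ w₁ ≅ t₄ ≫ t₂ ≫ w₂) :
    (t₃ ≫ t₁) ≫ w₁ ≫ p ≅ (t₄ ≫ t₂) ≫ w₂ ≫ p :=
  Iso.refl _ ≪⊗≫ whiskerRightIso φ p ≪⊗≫ Iso.refl _

end Pasting

section TwoMorphisms

variable {C : Type u} [Bicategory.{w, v} C]

theorem rel_paste {X₁ X₂ Y Y' Y'' E F H B : C} {c₁ : X₁ ⟶ B} {c₂ : X₂ ⟶ B}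
    {a₁ : Y ⟶ X₁} {a₂ : Y ⟶ X₂} {a₁' : Y' ⟶ X₁} {a₂' : Y' ⟶ X₂} {a₁'' : Y'' ⟶ X₁}
    {a₂'' : Y'' ⟶ X₂} {z : E ⟶ Y} {z' : E ⟶ Y'} {y : F ⟶ Y'} {y'' : F ⟶ Y''}
    {p : H ⟶ E} {q : H ⟶ F}
    (σ₁ : z' ≫ a₁' ≅ z ≫ a₁) (σ₂ : z ≫ a₂ ≅ z' ≫ a₂')
    (τ₁ : y'' ≫ a₁'' ≅ y ≫ a₁') (τ₂ : y ≫ a₂' ≅ y'' ≫ a₂'')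
    (κ : p ≫ z' ≅ q ≫ y)
    (x : a₁ ≫ c₁ ⟶ a₂ ≫ c₂) (x' : a₁' ≫ c₁ ⟶ a₂' ≫ c₂) (x'' : a₁'' ≫ c₁ ⟶ a₂'' ≫ c₂)
    (h : σ₁.hom ▷ c₁ ≫ (α_ z a₁ c₁).hom ≫ z ◁ x ≫ (α_ z a₂ c₂).inv ≫ σ₂.hom ▷ c₂ =
      (α_ z' a₁' c₁).hom ≫ z' ◁ x' ≫ (α_ z' a₂' c₂).inv)
    (h' : τ₁.hom ▷ c₁ ≫ (α_ y a₁' c₁).hom ≫ y ◁ x' ≫ (α_ y a₂' c₂).inv ≫ τ₂.hom ▷ c₂ =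
      (α_ y'' a₁'' c₁).hom ≫ y'' ◁ x'' ≫ (α_ y'' a₂'' c₂).inv) :
    (Iso.refl _ ≪⊗≫ whiskerLeftIso q τ₁ ≪⊗≫ whiskerRightIso κ.symm a₁' ≪⊗≫
        whiskerLeftIso p σ₁ ≪⊗≫ Iso.refl ((p ≫ z) ≫ a₁) : (q ≫ y'') ≫ a₁'' ≅ _).hom ▷ c₁ ≫
      (α_ (p ≫ z) a₁ c₁).hom ≫ (p ≫ z) ◁ x ≫ (α_ (p ≫ z) a₂ c₂).inv ≫
      (Iso.refl _ ≪⊗≫ whiskerLeftIso p σ₂ ≪⊗≫ whiskerRightIso κ a₂' ≪⊗≫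
        whiskerLeftIso q τ₂ ≪⊗≫ Iso.refl ((q ≫ y'') ≫ a₂'') : (p ≫ z) ≫ a₂ ≅ _).hom ▷ c₂ =
      (α_ (q ≫ y'') a₁'' c₁).hom ≫ (q ≫ y'') ◁ x'' ≫ (α_ (q ≫ y'') a₂'' c₂).inv := by
  simp only [bicategoricalIsoComp, Iso.trans_hom, whiskerLeftIso_hom, whiskerRightIso_hom,
    Iso.refl_hom, Iso.symm_hom]
  calc
    _ = 𝟙 _ ⊗≫ q ◁ τ₁.hom ▷ c₁ ⊗≫ κ.inv ▷ (a₁' ≫ c₁) ⊗≫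
        p ◁ (σ₁.hom ▷ c₁ ≫ (α_ z a₁ c₁).hom ≫ z ◁ x ≫ (α_ z a₂ c₂).inv ≫ σ₂.hom ▷ c₂) ⊗≫
        κ.hom ▷ (a₂' ≫ c₂) ⊗≫ q ◁ τ₂.hom ▷ c₂ ⊗≫ 𝟙 _ := by bicategory
    _ = 𝟙 _ ⊗≫ q ◁ τ₁.hom ▷ c₁ ⊗≫ (κ.inv ▷ (a₁' ≫ c₁) ≫ (p ≫ z') ◁ x') ⊗≫
        κ.hom ▷ (a₂' ≫ c₂) ⊗≫ q ◁ τ₂.hom ▷ c₂ ⊗≫ 𝟙 _ := by rw [h]; bicategory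
    _ = 𝟙 _ ⊗≫ q ◁ τ₁.hom ▷ c₁ ⊗≫ (q ≫ y) ◁ x' ⊗≫ (κ.inv ≫ κ.hom) ▷ (a₂' ≫ c₂) ⊗≫
        q ◁ τ₂.hom ▷ c₂ ⊗≫ 𝟙 _ := by rw [← whisker_exchange]; bicategory
    _ = 𝟙 _ ⊗≫ q ◁ (τ₁.hom ▷ c₁ ≫ (α_ y a₁' c₁).hom ≫ y ◁ x' ≫ (α_ y a₂' c₂).inv ≫
        τ₂.hom ▷ c₂) ⊗≫ 𝟙 _ := by rw [Iso.inv_hom_id]; bicategory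
    _ = _ := by rw [h']; bicategory

variable {W : MorphismProperty C} [AdmitsBicalculus W] {A B : C} {s t : FracMor W A B}

theorem FracRep.rel_refl (r : FracRep s t) : r.Rel r :=
  ⟨r.apex, 𝟙 _, 𝟙 _, Iso.refl _, Iso.refl _,
    AdmitsBicalculus.bf2 _ _ (AdmitsBicalculus.bf1 _) r.mem, by simp, by simp⟩

theorem FracRep.rel_symm {r r' : FracRep s t} (h : r.Rel r') : r'.Rel r := by
  obtain ⟨E, z, z', σ₁, σ₂, hW, hα, hβ⟩ := h
  refine ⟨E, z', z, σ₁.symm, σ₂.symm, ?_, ?_, ?_⟩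
  · exact AdmitsBicalculus.bf5 _ _ hW
      ((α_ _ _ _).symm ≪≫ whiskerRightIso σ₁ s.w ≪≫ α_ _ _ _)
  · have := congrArg (fun x => σ₁.inv ▷ s.w ≫ x ≫ σ₂.inv ▷ t.w) hα
    simp only [Category.assoc, inv_hom_whiskerRight_assoc, hom_inv_whiskerRight] at this
    simpa using this.symm
  · have := congrArg (fun x => σ₁.inv ▷ s.f ≫ x ≫ σ₂.inv ▷ t.f) hβ
    simp only [Category.assoc, inv_hom_whiskerRight_assoc, hom_inv_whiskerRight] at this
    simpa using this.symm

theorem FracRep.rel_trans {r r' r'' : FracRep s t} (h : r.Rel r') (h' : r'.Rel r'') : r.Rel r'' := by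
  obtain ⟨E, z, z', σ₁, σ₂, hW, hα, hβ⟩ := h
  obtain ⟨F, y, y'', τ₁, τ₂, hW', hα', hβ'⟩ := h'
  obtain ⟨⟨G, e, e', he, ι⟩⟩ :=
    AdmitsBicalculus.bf3 (W := W) (z' ≫ r'.v₁ ≫ s.w) (y ≫ r'.v₁ ≫ s.w) hW'
  obtain ⟨⟨H, p, hp, κ, _⟩, hκ⟩ := AdmitsBicalculus.bf4ab (W := W) (r'.v₁ ≫ s.w) r'.mem
    (e ≫ z') (e' ≫ y) ((α_ _ _ _).hom ≫ ι.hom ≫ (α_ _ _ _).inv)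
  have hκ' : IsIso κ := hκ inferInstance
  let κ' : (p ≫ e) ≫ z' ≅ (p ≫ e') ≫ y := α_ _ _ _ ≪≫ asIso κ ≪≫ (α_ _ _ _).symm
  refine ⟨H, (p ≫ e) ≫ z, (p ≫ e') ≫ y'', _, _, ?_,
    rel_paste σ₁ σ₂ τ₁ τ₂ κ' _ _ _ hα hα', rel_paste σ₁ σ₂ τ₁ τ₂ κ' _ _ _ hβ hβ'⟩
  exact AdmitsBicalculus.bf5 _ _
    (AdmitsBicalculus.bf2 _ _ (AdmitsBicalculus.bf2 _ _ hp he) hW) (α_ _ _ _)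

/-- The relation on representatives is an equivalence relation. -/
instance FracRep.setoid (s t : FracMor W A B) : Setoid (FracRep s t) where
  r := FracRep.Rel
  iseqv := ⟨FracRep.rel_refl, FracRep.rel_symm, FracRep.rel_trans⟩

/-- The 2-morphisms `s ⟹ t` of the bicategory of fractions. -/
abbrev TwoMor (s t : FracMor W A B) := Quotient (FracRep.setoid s t)

/-- The data `r` represent the 2-morphism `Γ`. -/
def FracRep.Represents (r : FracRep s t) (Γ : TwoMor s t) : Prop := ⟦r⟧ = Γ

/-- The composite `g ∘ f` of 1-morphisms determined by the choices `C(W)`. -/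
def ChoicesC.comp (cC : ChoicesC W) {Z : C} (f : FracMor W A B) (g : FracMor W B Z) : FracMor W A Z where
  apex := (cC.fill f.f g.w g.mem).apex
  w := (cC.fill f.f g.w g.mem).v' ≫ f.w
  mem := AdmitsBicalculus.bf2 _ _ (cC.fill f.f g.w g.mem).mem f.mem
  f := (cC.fill f.f g.w g.mem).f' ≫ g.f

end TwoMorphisms

section Whiskering

variable {C : Type u} [Bicategory.{w, v} C] {W : MorphismProperty C}

theorem FracRep.mem₂ [AdmitsBicalculus W] {A B : C} {s t : FracMor W A B} (r : FracRep s t) :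
    W (r.v₂ ≫ t.w) :=
  AdmitsBicalculus.bf5 _ _ r.mem r.α.symm

/-- Auxiliary data for the composite with `f = (A', w, f)` of the 2-morphism represented by
`r = (B³, u¹, u², α, β)`, from `g¹ = (B¹, v¹, g¹)` to `g² = (B², v², g²)`, where
`(D^m, w^m, f^m, ρ^m)` is the square chosen by `C(W)` for the pair `(f, v^m)`. -/
structure WhiskerData (cC : ChoicesC W) {A B Z : C} (f : FracMor W A B) {g₁ g₂ : FracMor W B Z}
    (r : FracRep g₁ g₂) where
  /-- `(D³, t¹, h¹, σ¹)` -/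
  S₁ : Filler W (cC.fill f.f g₁.w g₁.mem).f' r.v₁
  /-- `(D⁴, t², h², σ²)` -/
  S₂ : Filler W (cC.fill f.f g₂.w g₂.mem).f' r.v₂
  /-- `(D⁵, t³, t⁴, φ)` over the pair `(w¹ ∘ t¹, w² ∘ t²)` -/
  S₃ : Filler W (S₁.v' ≫ (cC.fill f.f g₁.w g₁.mem).v') (S₂.v' ≫ (cC.fill f.f g₂.w g₂.mem).v')
  δ : S₃.v' ≫ S₁.f' ≅ S₃.f' ≫ S₂.f'
  eq : δ.hom ▷ (r.v₁ ≫ g₁.w) =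
    zigzag (cC.fill f.f g₁.w g₁.mem).ρ (cC.fill f.f g₂.w g₂.mem).ρ r.α S₁.ρ S₂.ρ S₃.ρ

/-- The diagram `(D⁵, t¹ ∘ t³, t² ∘ t⁴, w ∘ φ, ξ)` induced by the auxiliary data. -/
def WhiskerData.diagram [AdmitsBicalculus W] {cC : ChoicesC W} {A B Z : C} {f : FracMor W A B}
    {g₁ g₂ : FracMor W B Z} {r : FracRep g₁ g₂} (F : WhiskerData cC f r) :
    FracRep (cC.comp f g₁) (cC.comp f g₂) where
  apex := F.S₃.apex
  v₁ := F.S₃.v' ≫ F.S₁.v'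
  v₂ := F.S₃.f' ≫ F.S₂.v'
  mem := AdmitsBicalculus.bf2 _ _ (AdmitsBicalculus.bf2 _ _ F.S₃.mem F.S₁.mem)
    (cC.comp f g₁).mem
  α := postcomp f.w F.S₃.ρ
  β := xi F.S₁.ρ F.S₂.ρ F.δ.hom r.β

/-- A square like `S₁` and `S₂` in `WhiskerData`, but with `w^m ∘ t` (instead of `t`) in `W`. -/
structure Leg (W : MorphismProperty C) {A' Y X D : C} (w' : D ⟶ A') (f' : D ⟶ Y) (u : X ⟶ Y) where
  apex : C
  t : apex ⟶ D
  h : apex ⟶ X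
  mem : W (t ≫ w')
  σ : t ≫ f' ≅ h ≫ u

/-- First half of Pronk's construction of `Δ ∘ f`, carried out for `m = 1` and `m = 2`. It is
applied to `f = (A', w, f)`, to `g = (B^m, v^m, g^m)` and to a morphism `u : B³ ⟶ B^m` such that
`v^m ∘ u` is in `W`. The steps are:
* `S = (D^m, w^m, f^m, ρ)` is the square chosen by `C(W)` for `(f, v^m)`;
* `T = (R, k, h, τ)` is the square chosen by `C(W)` for `(f, v^m ∘ u)`;
* `L = (R', a, b, l)` is the square chosen by `C(W)` for `(k, w^m)`, so `l : k ∘ a ⟹ w^m ∘ b`;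
* `θ` is the pasting `v^m ∘ f^m ∘ b ⟹ f ∘ w^m ∘ b ⟹ f ∘ k ∘ a ⟹ v^m ∘ u ∘ h ∘ a` of
  `ρ⁻¹`, `l⁻¹` and `τ`;
* `D(W)` chooses for `θ` a morphism `c` in `W` and an invertible
  `σ : f^m ∘ b ∘ c ⟹ u ∘ h ∘ a ∘ c` with `v^m ∘ σ = θ ∘ c`. -/
noncomputable def pronkLeg [AdmitsBicalculus W] (cC : ChoicesC W) (cD : ChoicesD W) {A B Z X : C}
    (f : FracMor W A B) (g : FracMor W B Z) (u : X ⟶ g.apex) (hu : W (u ≫ g.w)) :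
    Leg W (cC.fill f.f g.w g.mem).v' (cC.fill f.f g.w g.mem).f' u :=
  let S := cC.fill f.f g.w g.mem
  let T := cC.fill f.f (u ≫ g.w) hu
  let L := cC.fill T.v' S.v' S.mem
  let θ : (L.f' ≫ S.f') ≫ g.w ≅ (L.v' ≫ T.f' ≫ u) ≫ g.w :=
    Iso.refl _ ≪⊗≫ whiskerLeftIso L.f' S.ρ.symm ≪⊗≫ whiskerRightIso L.ρ.symm f.f ≪⊗≫
      whiskerLeftIso L.v' T.ρ ≪⊗≫ Iso.refl _
  let c := cD.lift g.w g.mem (L.f' ≫ S.f') (L.v' ≫ T.f' ≫ u) θ.hom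
  { apex := c.apex
    t := c.v ≫ L.f'
    h := c.v ≫ L.v' ≫ T.f'
    mem := AdmitsBicalculus.bf5 _ _
      (AdmitsBicalculus.bf2 _ _ c.mem (AdmitsBicalculus.bf2 _ _ L.mem T.mem))
      (α_ _ _ _ ≪≫ whiskerLeftIso c.v L.ρ.symm)
    σ := Iso.refl _ ≪⊗≫ cD.liftIso g.w g.mem (L.f' ≫ S.f') (L.v' ≫ T.f' ≫ u) θ ≪⊗≫ Iso.refl _ }

/-- Pronk's construction of a representative of `Δ ∘ f` from a representative
`r = (B³, u¹, u², α, β)` of `Δ : g¹ ⟹ g²` and the choices `C(W)`, `D(W)`: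
* `P^m = (D^{m+2}, t^m, h^m, σ^m)` is given by `pronkLeg`;
* `Q = (R, a, b, φ)` is the square chosen by `C(W)` for `(w¹ ∘ t¹, w² ∘ t²)`;
* `K = (D⁵, c, δ)` is chosen by `D(W)` for `v¹ ∘ u¹` and the pasting of `(σ¹)⁻¹`, `(ρ¹)⁻¹`, `φ`,
  `ρ²`, `σ²` and `α⁻¹`;
* the result is `(D⁵, t¹ ∘ (a ∘ c), t² ∘ (b ∘ c), w ∘ (φ ∘ c), ξ)`. -/
noncomputable def pronkRep [AdmitsBicalculus W] (cC : ChoicesC W) (cD : ChoicesD W) {A B Z : C}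
    (f : FracMor W A B) {g₁ g₂ : FracMor W B Z} (r : FracRep g₁ g₂) :
    FracRep (cC.comp f g₁) (cC.comp f g₂) :=
  let S₁ := cC.fill f.f g₁.w g₁.mem
  let S₂ := cC.fill f.f g₂.w g₂.mem
  let P₁ := pronkLeg cC cD f g₁ r.v₁ r.mem
  let P₂ := pronkLeg cC cD f g₂ r.v₂ r.mem₂
  let Q := cC.fill (P₁.t ≫ S₁.v') (P₂.t ≫ S₂.v') P₂.mem
  let K := cD.lift (r.v₁ ≫ g₁.w) r.mem (Q.v' ≫ P₁.h) (Q.f' ≫ P₂.h)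
    (zigzag S₁.ρ S₂.ρ r.α P₁.σ P₂.σ Q.ρ)
  let φ : (K.v ≫ Q.v') ≫ P₁.t ≫ S₁.v' ≅ (K.v ≫ Q.f') ≫ P₂.t ≫ S₂.v' :=
    α_ _ _ _ ≪≫ whiskerLeftIso K.v Q.ρ ≪≫ (α_ _ _ _).symm
  let δ : (K.v ≫ Q.v') ≫ P₁.h ⟶ (K.v ≫ Q.f') ≫ P₂.h :=
    (α_ _ _ _).hom ≫ K.β ≫ (α_ _ _ _).inv
  { apex := K.apex
    v₁ := (K.v ≫ Q.v') ≫ P₁.t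
    v₂ := (K.v ≫ Q.f') ≫ P₂.t
    mem := AdmitsBicalculus.bf5 _ _
      (AdmitsBicalculus.bf2 _ _ (AdmitsBicalculus.bf2 _ _ K.mem Q.mem)
        (AdmitsBicalculus.bf2 _ _ P₁.mem f.mem))
      (α_ _ _ _ ≪≫ whiskerLeftIso (K.v ≫ Q.v') (α_ _ _ _).symm)
    α := postcomp f.w φ
    β := xi P₁.σ P₂.σ δ r.β }

/-- The horizontal composite `Γ ∘ f` in the bicategory of fractions built from the choices `C(W)`
and `D(W)`: the class of Pronk's diagram for some representative of `Γ`. -/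
noncomputable def compLeft [AdmitsBicalculus W] (cC : ChoicesC W) (cD : ChoicesD W) {A B Z : C}
    (f : FracMor W A B) {g₁ g₂ : FracMor W B Z} (Γ : TwoMor g₁ g₂) :
    TwoMor (cC.comp f g₁) (cC.comp f g₂) :=
  ⟦pronkRep cC cD f Γ.out⟧

end Whiskering

end BicategoryOfFractions

open BicategoryOfFractions

/-!
A diagram `d` represents `[r] ∘ f` as soon as it maps to `r`: there is a morphism `k` from the apex
of `d` to the apex of `r`, and 2-morphisms `σ₁`, `σ₂`, `φ` which together with the squares `ρ¹`,
`ρ²` paste to the first 2-morphism of `r` and determine both 2-morphisms of `d`. Pronk's diagram and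
the diagrams induced by (F5)–(F7) are of this kind, with `k = h² ∘ t⁴`.

By (BF4), postcomposition with a morphism of `W` is full and faithful on 2-morphisms up to
restriction along a morphism of `W`. Hence two diagrams over the same `r` can be restricted to a
common apex on which first `φ`, then `σ₁`, and by pasting `σ₂` agree, so that they are equivalent.
Finally a diagram over `r` becomes, after restriction, one over any equivalent representative.
-/

namespace BicategoryOfFractions

section Cells

variable {C : Type u} [Bicategory.{w, v} C]

/-- Whiskering of a 2-morphism `q ∘ x ⟹ q' ∘ y` with a 1-morphism `g` after it, with the
composites bracketed as `(g ∘ q) ∘ x` and `(g ∘ q') ∘ y`. -/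
def postwhisker {X Y Y' Q R : C} {x : X ⟶ Y} {y : X ⟶ Y'} {q : Y ⟶ Q} {q' : Y' ⟶ Q}
    (m : x ≫ q ⟶ y ≫ q') (g : Q ⟶ R) : x ≫ q ≫ g ⟶ y ≫ q' ≫ g :=
  (α_ x q g).inv ≫ m ▷ g ≫ (α_ y q' g).hom

/-- Whiskering of a 2-morphism `q ∘ x ⟹ q' ∘ y` with a 1-morphism `e` before it, with the
composites bracketed as `q ∘ (x ∘ e)` and `q' ∘ (y ∘ e)`. -/
def prewhisker {E X Y Y' Q : C} {x : X ⟶ Y} {y : X ⟶ Y'} {q : Y ⟶ Q} {q' : Y' ⟶ Q}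
    (e : E ⟶ X) (m : x ≫ q ⟶ y ≫ q') : (e ≫ x) ≫ q ⟶ (e ≫ y) ≫ q' :=
  (α_ e x q).hom ≫ e ◁ m ≫ (α_ e y q').inv

variable {E X Y Y' Y'' Q R : C} {x : X ⟶ Y} {y : X ⟶ Y'} {z : X ⟶ Y''}
  {q : Y ⟶ Q} {q' : Y' ⟶ Q} {q'' : Y'' ⟶ Q}

theorem postwhisker_comp (m : x ≫ q ⟶ y ≫ q') (n : y ≫ q' ⟶ z ≫ q'') (g : Q ⟶ R) :
    postwhisker (m ≫ n) g = postwhisker m g ≫ postwhisker n g := by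
  simp [postwhisker]

theorem prewhisker_comp (e : E ⟶ X) (m : x ≫ q ⟶ y ≫ q') (n : y ≫ q' ⟶ z ≫ q'') :
    prewhisker e (m ≫ n) = prewhisker e m ≫ prewhisker e n := by
  simp [prewhisker]

theorem commSq_prewhisker {X Y₁ Y₂ Y₃ Y₄ Q : C} {x₁ : X ⟶ Y₁} {x₂ : X ⟶ Y₂} {x₃ : X ⟶ Y₃}
    {x₄ : X ⟶ Y₄} {q₁ : Y₁ ⟶ Q} {q₂ : Y₂ ⟶ Q} {q₃ : Y₃ ⟶ Q} {q₄ : Y₄ ⟶ Q}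
    {a : x₁ ≫ q₁ ⟶ x₂ ≫ q₂} {b : x₁ ≫ q₁ ⟶ x₃ ≫ q₃} {c : x₂ ≫ q₂ ⟶ x₄ ≫ q₄}
    {d : x₃ ≫ q₃ ⟶ x₄ ≫ q₄} (h : CommSq a b c d) (e : E ⟶ X) :
    CommSq (prewhisker e a) (prewhisker e b) (prewhisker e c) (prewhisker e d) :=
  ⟨by rw [← prewhisker_comp, h.w, prewhisker_comp]⟩

theorem postwhisker_whiskerRight {x x' : X ⟶ Y} (η : x ⟶ x') (q : Y ⟶ Q) (g : Q ⟶ R) :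
    postwhisker (η ▷ q) g = η ▷ (q ≫ g) := by
  simp [postwhisker]

theorem prewhisker_whiskerLeft {q q' : Y ⟶ Q} (e : E ⟶ X) (x : X ⟶ Y) (γ : q ⟶ q') :
    prewhisker e (x ◁ γ) = (e ≫ x) ◁ γ := by
  simp [prewhisker]

theorem postwhisker_prewhisker (e : E ⟶ X) (m : x ≫ q ⟶ y ≫ q') (g : Q ⟶ R) :
    postwhisker (prewhisker e m) g = prewhisker e (postwhisker m g) := by
  simp only [postwhisker, prewhisker]
  bicategory

theorem whiskerLeft_postwhisker (e : E ⟶ X) (m : x ≫ q ⟶ y ≫ q') (g : Q ⟶ R) :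
    e ◁ postwhisker m g =
      e ◁ (α_ x q g).inv ≫ postwhisker (e ◁ m) g ≫ e ◁ (α_ y q' g).hom := by
  simp [postwhisker]

theorem postwhisker_postwhisker (m : x ≫ q ⟶ y ≫ q') {S : C} (g : Q ⟶ R) (h : R ⟶ S) :
    postwhisker m (g ≫ h) =
      x ◁ (α_ q g h).inv ≫ postwhisker (postwhisker m g) h ≫ y ◁ (α_ q' g h).hom := by
  simp only [postwhisker]
  bicategory

/-- The invertible version of `postwhisker`. -/
def postwhiskerIso (m : x ≫ q ≅ y ≫ q') (g : Q ⟶ R) : x ≫ q ≫ g ≅ y ≫ q' ≫ g :=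
  (α_ x q g).symm ≪≫ whiskerRightIso m g ≪≫ α_ y q' g

@[simp]
theorem postwhiskerIso_hom (m : x ≫ q ≅ y ≫ q') (g : Q ⟶ R) :
    (postwhiskerIso m g).hom = postwhisker m.hom g :=
  rfl

@[simp]
theorem postwhiskerIso_inv (m : x ≫ q ≅ y ≫ q') (g : Q ⟶ R) :
    (postwhiskerIso m g).inv = postwhisker m.inv g :=
  Category.assoc _ _ _

/-- The invertible version of `prewhisker`. -/
def prewhiskerIso (e : E ⟶ X) (m : x ≫ q ≅ y ≫ q') : (e ≫ x) ≫ q ≅ (e ≫ y) ≫ q' :=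
  α_ e x q ≪≫ whiskerLeftIso e m ≪≫ (α_ e y q').symm

@[simp]
theorem prewhiskerIso_hom (e : E ⟶ X) (m : x ≫ q ≅ y ≫ q') :
    (prewhiskerIso e m).hom = prewhisker e m.hom :=
  rfl

@[simp]
theorem prewhiskerIso_inv (e : E ⟶ X) (m : x ≫ q ≅ y ≫ q') :
    (prewhiskerIso e m).inv = prewhisker e m.inv :=
  Category.assoc _ _ _

end Cells

section Compatible

variable {C : Type u} [Bicategory.{w, v} C]

/-- The 2-morphisms `m` and `m'` agree after whiskering with `e` and `e'`, up to the 2-morphisms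
`a` and `b` comparing their sources and their targets. -/
def Compatible {E X X' Y Y' Q : C} {e : E ⟶ X} {e' : E ⟶ X'} {x : X ⟶ Y} {x' : X' ⟶ Y}
    {y : X ⟶ Y'} {y' : X' ⟶ Y'} {q : Y ⟶ Q} {q' : Y' ⟶ Q}
    (m : x ≫ q ⟶ y ≫ q') (m' : x' ≫ q ⟶ y' ≫ q')
    (a : e ≫ x ⟶ e' ≫ x') (b : e ≫ y ⟶ e' ≫ y') : Prop :=
  CommSq (e ◁ m) (postwhisker a q) (postwhisker b q') (e' ◁ m')

variable {E X X' X'' Y Y' Y'' Q R : C} {e : E ⟶ X} {e' : E ⟶ X'} {e'' : E ⟶ X''}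
  {x : X ⟶ Y} {x' : X' ⟶ Y} {x'' : X'' ⟶ Y} {y : X ⟶ Y'} {y' : X' ⟶ Y'} {y'' : X'' ⟶ Y'}
  {z : X ⟶ Y''} {z' : X' ⟶ Y''} {q : Y ⟶ Q} {q' : Y' ⟶ Q} {q'' : Y'' ⟶ Q}

theorem compatible_iff {m : x ≫ q ⟶ y ≫ q'} {m' : x' ≫ q ⟶ y' ≫ q'}
    {a : e ≫ x ⟶ e' ≫ x'} {b : e ≫ y ⟶ e' ≫ y'} :
    Compatible m m' a b ↔ e ◁ m ≫ postwhisker b q' = postwhisker a q ≫ e' ◁ m' :=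
  ⟨fun h => h.w, fun h => ⟨h⟩⟩

theorem compatible_inv_iff {m : x ≫ q ⟶ y ≫ q'} {m' : x' ≫ q ⟶ y' ≫ q'}
    {a : e' ≫ x' ≅ e ≫ x} {b : e ≫ y ⟶ e' ≫ y'} :
    Compatible m m' a.inv b ↔
      a.hom ▷ q ≫ (α_ e x q).hom ≫ e ◁ m ≫ (α_ e y q').inv ≫ b ▷ q' =
        (α_ e' x' q).hom ≫ e' ◁ m' ≫ (α_ e' y' q').inv := by
  rw [compatible_iff, ← postwhiskerIso_inv, Iso.eq_inv_comp,
    ← cancel_epi (α_ e' x' q).inv, ← cancel_mono (α_ e' y' q').hom]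
  simp [postwhisker]

namespace Compatible

variable {m : x ≫ q ⟶ y ≫ q'} {m' : x' ≫ q ⟶ y' ≫ q'} {m'' : x'' ≫ q ⟶ y'' ≫ q'}
  {n : y ≫ q' ⟶ z ≫ q''} {n' : y' ≫ q' ⟶ z' ≫ q''}
  {a : e ≫ x ⟶ e' ≫ x'} {b : e ≫ y ⟶ e' ≫ y'} {c : e ≫ z ⟶ e' ≫ z'}

theorem comp (h : Compatible m m' a b) (k : Compatible n n' b c) :
    Compatible (m ≫ n) (m' ≫ n') a c := by
  simpa only [Compatible, Bicategory.whiskerLeft_comp] using CommSq.horiz_comp h k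

theorem trans {a' : e' ≫ x' ⟶ e'' ≫ x''} {b' : e' ≫ y' ⟶ e'' ≫ y''}
    (h : Compatible m m' a b) (h' : Compatible m' m'' a' b') :
    Compatible m m'' (a ≫ a') (b ≫ b') := by
  simpa only [Compatible, postwhisker_comp] using CommSq.vert_comp h h'

theorem inv {m : x ≫ q ≅ y ≫ q'} {m' : x' ≫ q ≅ y' ≫ q'}
    (h : Compatible m.hom m'.hom a b) : Compatible m.inv m'.inv b a :=
  CommSq.horiz_inv (f := whiskerLeftIso e m) (i := whiskerLeftIso e' m') h

theorem whiskerLeft {q₁ q₂ : Y ⟶ Q} (a : e ≫ x ⟶ e' ≫ x') (γ : q₁ ⟶ q₂) :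
    Compatible (x ◁ γ) (x' ◁ γ) a a :=
  compatible_iff.2 <| by
    rw [postwhisker, postwhisker, ← cancel_epi (α_ e x q₁).hom, ← cancel_mono (α_ e' x' q₂).inv]
    simpa using whisker_exchange a γ

theorem whiskerRight {e e' : E ⟶ X} (κ : e ⟶ e') (m : x ≫ q ⟶ y ≫ q') :
    Compatible m m (κ ▷ x) (κ ▷ y) :=
  ⟨by simp only [postwhisker_whiskerRight, whisker_exchange]⟩

theorem leftUnitor_inv (e : E ⟶ X) (m : x ≫ q ⟶ y ≫ q') :
    Compatible m (prewhisker e m) (λ_ (e ≫ x)).inv (λ_ (e ≫ y)).inv :=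
  ⟨by simp only [postwhisker, prewhisker]; bicategory⟩

theorem prewhisker {F : C} (v : F ⟶ E) (h : Compatible m m' a b) :
    Compatible m m' (prewhisker v a) (prewhisker v b) := by
  simpa only [Compatible, prewhisker_whiskerLeft, postwhisker_prewhisker] using
    commSq_prewhisker h v

end Compatible

theorem compatible_postwhisker_iff {m : x ≫ q ⟶ y ≫ q'} {m' : x' ≫ q ⟶ y' ≫ q'}
    {a : e ≫ x ⟶ e' ≫ x'} {b : e ≫ y ⟶ e' ≫ y'} {g : Q ⟶ R} :
    Compatible (postwhisker m g) (postwhisker m' g) a b ↔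
      postwhisker (e ◁ m ≫ postwhisker b q') g = postwhisker (postwhisker a q ≫ e' ◁ m') g := by
  rw [compatible_iff]
  simp only [whiskerLeft_postwhisker, postwhisker_postwhisker, postwhisker_comp, Category.assoc,
    whiskerLeft_hom_inv_assoc, cancel_epi]
  simp only [← Category.assoc, cancel_mono]

theorem Compatible.postwhisker {m : x ≫ q ⟶ y ≫ q'} {m' : x' ≫ q ⟶ y' ≫ q'}
    {a : e ≫ x ⟶ e' ≫ x'} {b : e ≫ y ⟶ e' ≫ y'} (h : Compatible m m' a b) (g : Q ⟶ R) :
    Compatible (postwhisker m g) (postwhisker m' g) a b :=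
  compatible_postwhisker_iff.2 (by rw [h.w])

end Compatible

section Fractions

variable {C : Type u} [Bicategory.{w, v} C] {W : MorphismProperty C}

theorem Lift.prewhisker_eq {X B A : C} {w : B ⟶ A} {f₁ f₂ : X ⟶ B} {α : f₁ ≫ w ⟶ f₂ ≫ w}
    (L : Lift W w f₁ f₂ α) : prewhisker L.v α = L.β ▷ w := by
  simp [prewhisker, L.eq]

variable [AdmitsBicalculus W] {E X Y Q R : C} {x : E ⟶ X} {y : E ⟶ Y}

theorem exists_postwhisker_eq {q : X ⟶ Q} {q' : Y ⟶ Q} {g : Q ⟶ R} (hg : W g)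
    (γ : x ≫ q ≫ g ≅ y ≫ q' ≫ g) :
    ∃ (F : C) (v : F ⟶ E) (b : (v ≫ x) ≫ q ≅ (v ≫ y) ≫ q'), W v ∧
      postwhisker b.hom g = prewhisker v γ.hom := by
  obtain ⟨L, hL⟩ := AdmitsBicalculus.bf4ab g hg (x ≫ q) (y ≫ q')
    ((α_ x q g).hom ≫ γ.hom ≫ (α_ y q' g).inv)
  have : IsIso L.β := hL inferInstance
  refine ⟨L.apex, L.v, α_ _ _ _ ≪≫ asIso L.β ≪≫ (α_ _ _ _).symm, L.mem, ?_⟩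
  have hLβ := L.prewhisker_eq
  simp [postwhisker, ← hLβ, prewhisker]

theorem exists_whiskerLeft_eq {f₁ f₂ : X ⟶ Y} {g : Y ⟶ R} (hg : W g) {β β' : f₁ ⟶ f₂}
    (h : β ▷ g = β' ▷ g) : ∃ (F : C) (v : F ⟶ X), W v ∧ v ◁ β = v ◁ β' := by
  obtain ⟨F, u, u', ζ, hu, hζ⟩ := AdmitsBicalculus.bf4c (W := W) g hg _ _ (β ▷ g)
    ⟨X, 𝟙 X, AdmitsBicalculus.bf1 X, 𝟙 X ◁ β, by simp⟩
    ⟨X, 𝟙 X, AdmitsBicalculus.bf1 X, 𝟙 X ◁ β', by simp [h]⟩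
  dsimp only at u u' ζ hu hζ
  have hβ : (u ≫ 𝟙 X) ◁ β' ≫ ζ.hom ▷ f₂ = (u ≫ 𝟙 X) ◁ β ≫ ζ.hom ▷ f₂ := by
    rw [whisker_exchange, ← cancel_mono (α_ u' (𝟙 X) f₂).hom]
    simpa using hζ
  exact ⟨F, u ≫ 𝟙 X, hu, ((cancel_mono _).1 hβ).symm⟩

theorem exists_prewhisker_eq {q : X ⟶ Q} {q' : Y ⟶ Q} {g : Q ⟶ R} (hg : W g)
    {m m' : x ≫ q ⟶ y ≫ q'} (h : postwhisker m g = postwhisker m' g) :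
    ∃ (F : C) (v : F ⟶ E), W v ∧ prewhisker v m = prewhisker v m' := by
  have hm : m ▷ g = m' ▷ g := by simpa [postwhisker] using h
  obtain ⟨F, v, hv, hvm⟩ := exists_whiskerLeft_eq hg hm
  exact ⟨F, v, hv, by rw [prewhisker, prewhisker, hvm]⟩

/-- The right leg `q` of the cospan need not be in `W`, as long as some `g ∘ q` with `g` in `W`
is. -/
theorem exists_square {q : X ⟶ Q} {q' : Y ⟶ Q} {g : Q ⟶ R} (hg : W g) (hq' : W (q' ≫ g)) :
    ∃ (F : C) (e : F ⟶ X) (e' : F ⟶ Y), W e ∧ Nonempty (e ≫ q ≅ e' ≫ q') := by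
  obtain ⟨S⟩ := AdmitsBicalculus.bf3 (q ≫ g) (q' ≫ g) hq'
  obtain ⟨F, v, b, hv, -⟩ := exists_postwhisker_eq hg S.ρ
  exact ⟨F, v ≫ S.v', v ≫ S.f', AdmitsBicalculus.bf2 _ _ hv S.mem, ⟨b⟩⟩

variable {X' Y' : C} {e : E ⟶ X} {e' : E ⟶ X'} {x : X ⟶ Y} {x' : X' ⟶ Y}
  {y : X ⟶ Y'} {y' : X' ⟶ Y'} {q : Y ⟶ Q} {q' : Y' ⟶ Q}

theorem exists_compatible (hq' : W q') (m : x ≫ q ≅ y ≫ q') (m' : x' ≫ q ≅ y' ≫ q')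
    (a : e ≫ x ≅ e' ≫ x') :
    ∃ (F : C) (v : F ⟶ E) (b : (v ≫ e) ≫ y ≅ (v ≫ e') ≫ y'), W v ∧
      Compatible m.hom m'.hom (prewhisker v a.hom) b.hom := by
  obtain ⟨F, v, b, hv, hb⟩ := exists_postwhisker_eq hq'
    ((whiskerLeftIso e m).symm ≪≫ postwhiskerIso a q ≪≫ whiskerLeftIso e' m')
  refine ⟨F, v, b, hv, compatible_iff.2 ?_⟩
  rw [hb, postwhisker_prewhisker, ← prewhisker_whiskerLeft, ← prewhisker_whiskerLeft,
    ← prewhisker_comp, ← prewhisker_comp]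
  simp

theorem exists_compatible_of_postwhisker {g : Q ⟶ R} (hg : W g) {m : x ≫ q ⟶ y ≫ q'}
    {m' : x' ≫ q ⟶ y' ≫ q'} {a : e ≫ x ⟶ e' ≫ x'} {b : e ≫ y ⟶ e' ≫ y'}
    (h : Compatible (postwhisker m g) (postwhisker m' g) a b) :
    ∃ (F : C) (v : F ⟶ E), W v ∧ Compatible m m' (prewhisker v a) (prewhisker v b) := by
  obtain ⟨F, v, hv, hmm'⟩ := exists_prewhisker_eq hg (compatible_postwhisker_iff.1 h)
  refine ⟨F, v, hv, compatible_iff.2 ?_⟩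
  simpa only [prewhisker_comp, prewhisker_whiskerLeft, postwhisker_prewhisker] using hmm'

end Fractions

section Representatives

variable {C : Type u} [Bicategory.{w, v} C] {W : MorphismProperty C} {A B : C}
  {s t : FracMor W A B}

theorem FracRep.rel_of_compatible {r r' : FracRep s t} {E : C} {z : E ⟶ r.apex} {z' : E ⟶ r'.apex}
    (hz : W (z ≫ r.v₁ ≫ s.w)) (a₁ : z ≫ r.v₁ ≅ z' ≫ r'.v₁) (a₂ : z ≫ r.v₂ ≅ z' ≫ r'.v₂)
    (hα : Compatible r.α.hom r'.α.hom a₁.hom a₂.hom) (hβ : Compatible r.β r'.β a₁.hom a₂.hom) :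
    r.Rel r' :=
  ⟨E, z, z', a₁.symm, a₂, hz, compatible_inv_iff.1 hα, compatible_inv_iff.1 hβ⟩

theorem FracRep.Rel.exists_compatible {r r' : FracRep s t} (h : r.Rel r') :
    ∃ (E : C) (z : E ⟶ r.apex) (z' : E ⟶ r'.apex) (a₁ : z ≫ r.v₁ ≅ z' ≫ r'.v₁)
      (a₂ : z ≫ r.v₂ ≅ z' ≫ r'.v₂), W (z ≫ r.v₁ ≫ s.w) ∧
      Compatible r.α.hom r'.α.hom a₁.hom a₂.hom ∧ Compatible r.β r'.β a₁.hom a₂.hom := by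
  obtain ⟨E, z, z', σ₁, σ₂, hz, hα, hβ⟩ := h
  exact ⟨E, z, z', σ₁.symm, σ₂, hz, compatible_inv_iff.2 hα, compatible_inv_iff.2 hβ⟩

variable [AdmitsBicalculus W]

/-- The restriction of a representative along a morphism of `W`. -/
def FracRep.restrict (r : FracRep s t) {E : C} (e : E ⟶ r.apex) (he : W e) : FracRep s t where
  apex := E
  v₁ := e ≫ r.v₁
  v₂ := e ≫ r.v₂
  mem := AdmitsBicalculus.bf5 _ _ (AdmitsBicalculus.bf2 _ _ he r.mem) (α_ _ _ _)
  α := prewhiskerIso e r.α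
  β := prewhisker e r.β

theorem FracRep.rel_restrict (r : FracRep s t) {E : C} (e : E ⟶ r.apex) (he : W e) :
    r.Rel (r.restrict e he) :=
  FracRep.rel_of_compatible (AdmitsBicalculus.bf2 _ _ he r.mem) (λ_ (e ≫ r.v₁)).symm
    (λ_ (e ≫ r.v₂)).symm (Compatible.leftUnitor_inv e r.α.hom) (Compatible.leftUnitor_inv e r.β)

end Representatives

section SquarePasting

variable {C : Type u} [Bicategory.{w, v} C] {A' B B₁ B₂ D₁ D₂ X X' E : C} {f : A' ⟶ B}
  {w₁ : D₁ ⟶ A'} {w₂ : D₂ ⟶ A'} {f₁ : D₁ ⟶ B₁} {f₂ : D₂ ⟶ B₂} {v₁ : B₁ ⟶ B} {v₂ : B₂ ⟶ B}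
  {x₁ : X ⟶ D₁} {x₂ : X ⟶ D₂}

/-- The pasting of `φ : w₁ ∘ x₁ ⟹ w₂ ∘ x₂` with the squares `ρ₁` and `ρ₂`, from `(v₁ ∘ f₁) ∘ x₁` to
`(v₂ ∘ f₂) ∘ x₂`. -/
def squarePasting (ρ₁ : w₁ ≫ f ≅ f₁ ≫ v₁) (ρ₂ : w₂ ≫ f ≅ f₂ ≫ v₂) (φ : x₁ ≫ w₁ ≅ x₂ ≫ w₂) :
    x₁ ≫ f₁ ≫ v₁ ≅ x₂ ≫ f₂ ≫ v₂ :=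
  whiskerLeftIso x₁ ρ₁.symm ≪≫ postwhiskerIso φ f ≪≫ whiskerLeftIso x₂ ρ₂

theorem Compatible.squarePasting {x₁' : X' ⟶ D₁} {x₂' : X' ⟶ D₂} {e : E ⟶ X} {e' : E ⟶ X'}
    {φ : x₁ ≫ w₁ ≅ x₂ ≫ w₂} {φ' : x₁' ≫ w₁ ≅ x₂' ≫ w₂} {a₁ : e ≫ x₁ ⟶ e' ≫ x₁'}
    {a₂ : e ≫ x₂ ⟶ e' ≫ x₂'} (h : Compatible φ.hom φ'.hom a₁ a₂)
    (ρ₁ : w₁ ≫ f ≅ f₁ ≫ v₁) (ρ₂ : w₂ ≫ f ≅ f₂ ≫ v₂) :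
    Compatible (squarePasting ρ₁ ρ₂ φ).hom (squarePasting ρ₁ ρ₂ φ').hom a₁ a₂ :=
  (Compatible.whiskerLeft a₁ ρ₁.inv).comp
    ((h.postwhisker f).comp (Compatible.whiskerLeft a₂ ρ₂.hom))

theorem squarePasting_prewhiskerIso_hom (ρ₁ : w₁ ≫ f ≅ f₁ ≫ v₁) (ρ₂ : w₂ ≫ f ≅ f₂ ≫ v₂) (e : E ⟶ X)
    (φ : x₁ ≫ w₁ ≅ x₂ ≫ w₂) :
    (squarePasting ρ₁ ρ₂ (prewhiskerIso e φ)).hom = prewhisker e (squarePasting ρ₁ ρ₂ φ).hom := by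
  simp only [squarePasting, Iso.trans_hom, whiskerLeftIso_hom, Iso.symm_hom, postwhiskerIso_hom,
    prewhiskerIso_hom, prewhisker_comp, prewhisker_whiskerLeft, postwhisker_prewhisker]

end SquarePasting

theorem commSq_restrict {C : Type u} [Bicategory.{w, v} C] {E F X R R' Y₁ Y₂ U₁ U₂ Q : C}
    {x₁ : X ⟶ Y₁} {x₂ : X ⟶ Y₂} {f₁ : Y₁ ⟶ U₁} {f₂ : Y₂ ⟶ U₂} {c₁ : U₁ ⟶ Q} {c₂ : U₂ ⟶ Q}
    {u₁ : R ⟶ U₁} {u₂ : R ⟶ U₂} {u₁' : R' ⟶ U₁} {u₂' : R' ⟶ U₂} {k : X ⟶ R}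
    {y : x₁ ≫ f₁ ≫ c₁ ⟶ x₂ ≫ f₂ ≫ c₂} {s₁ : x₁ ≫ f₁ ⟶ k ≫ u₁} {s₂ : x₂ ≫ f₂ ⟶ k ≫ u₂}
    {m : u₁ ≫ c₁ ⟶ u₂ ≫ c₂} {m' : u₁' ≫ c₁ ⟶ u₂' ≫ c₂} {z : E ⟶ R} {z' : E ⟶ R'}
    {a₁ : z ≫ u₁ ⟶ z' ≫ u₁'} {a₂ : z ≫ u₂ ⟶ z' ≫ u₂'}
    (h : CommSq y (postwhisker s₁ c₁) (postwhisker s₂ c₂) (k ◁ m)) (hm : Compatible m m' a₁ a₂)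
    {e : F ⟶ X} {l : F ⟶ E} (κ : e ≫ k ⟶ l ≫ z) :
    CommSq (prewhisker e y) (postwhisker (prewhisker e s₁ ≫ κ ▷ u₁ ≫ prewhisker l a₁) c₁)
      (postwhisker (prewhisker e s₂ ≫ κ ▷ u₂ ≫ prewhisker l a₂) c₂) ((l ≫ z') ◁ m') := by
  have hκ := (Compatible.whiskerRight κ m).trans (hm.prewhisker l)
  have hy := commSq_prewhisker h e
  rw [prewhisker_whiskerLeft, ← postwhisker_prewhisker, ← postwhisker_prewhisker] at hy
  simpa only [postwhisker_comp] using hy.vert_comp hκ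

section Whiskering

variable {C : Type u} [Bicategory.{w, v} C] {W : MorphismProperty C} [AdmitsBicalculus W]
  {cC : ChoicesC W} {A B Z : C} {f : FracMor W A B} {g₁ g₂ : FracMor W B Z}

/-- A comparison of a diagram `d` with a representative `r` of a 2-morphism `Δ : g¹ ⟹ g²`, which
exhibits `d` as a representative of `Δ ∘ f`: a morphism `k` from `d` to `r` together with invertible
2-morphisms `σ₁`, `σ₂` and `φ`, such that the first 2-morphism of `d` is induced by `φ` and the
second one is the pasting of `σ₁`, the second 2-morphism of `r` and `σ₂⁻¹`. -/
structure Whiskering (cC : ChoicesC W) (f : FracMor W A B) (r : FracRep g₁ g₂)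
    (d : FracRep (cC.comp f g₁) (cC.comp f g₂)) where
  k : d.apex ⟶ r.apex
  σ₁ : d.v₁ ≫ (cC.fill f.f g₁.w g₁.mem).f' ≅ k ≫ r.v₁
  σ₂ : d.v₂ ≫ (cC.fill f.f g₂.w g₂.mem).f' ≅ k ≫ r.v₂
  φ : d.v₁ ≫ (cC.fill f.f g₁.w g₁.mem).v' ≅ d.v₂ ≫ (cC.fill f.f g₂.w g₂.mem).v'
  comm : CommSq (squarePasting (cC.fill f.f g₁.w g₁.mem).ρ (cC.fill f.f g₂.w g₂.mem).ρ φ).hom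
    (postwhisker σ₁.hom g₁.w) (postwhisker σ₂.hom g₂.w) (k ◁ r.α.hom)
  α_eq : d.α.hom = postwhisker φ.hom f.w
  β_comm : CommSq d.β (postwhisker σ₁.hom g₁.f) (postwhisker σ₂.hom g₂.f) (k ◁ r.β)

namespace Whiskering

variable {r r' : FracRep g₁ g₂} {d d' : FracRep (cC.comp f g₁) (cC.comp f g₂)} {E : C}
  {e : E ⟶ d.apex} {e' : E ⟶ d'.apex}

theorem compatible_postwhisker_σ₂ (H : Whiskering cC f r d) (H' : Whiskering cC f r d')
    {a₁ : e ≫ d.v₁ ⟶ e' ≫ d'.v₁} {a₂ : e ≫ d.v₂ ⟶ e' ≫ d'.v₂} {b : e ≫ H.k ⟶ e' ≫ H'.k}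
    (hφ : Compatible H.φ.hom H'.φ.hom a₁ a₂)
    (hσ₁ : Compatible (postwhisker H.σ₁.hom g₁.w) (postwhisker H'.σ₁.hom g₁.w) a₁ b) :
    Compatible (postwhisker H.σ₂.hom g₂.w) (postwhisker H'.σ₂.hom g₂.w) a₂ b := by
  have hψ := (hφ.squarePasting (cC.fill f.f g₁.w g₁.mem).ρ (cC.fill f.f g₂.w g₂.mem).ρ).inv
  rw [(Iso.eq_inv_comp _).2 H.comm.w, (Iso.eq_inv_comp _).2 H'.comm.w]
  exact hψ.comp (hσ₁.comp (Compatible.whiskerLeft b r.α.hom))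

theorem compatible_α (H : Whiskering cC f r d) (H' : Whiskering cC f r d')
    {a₁ : e ≫ d.v₁ ⟶ e' ≫ d'.v₁} {a₂ : e ≫ d.v₂ ⟶ e' ≫ d'.v₂}
    (hφ : Compatible H.φ.hom H'.φ.hom a₁ a₂) : Compatible d.α.hom d'.α.hom a₁ a₂ := by
  rw [H.α_eq, H'.α_eq]
  exact hφ.postwhisker f.w

theorem compatible_β (H : Whiskering cC f r d) (H' : Whiskering cC f r d')
    {a₁ : e ≫ d.v₁ ⟶ e' ≫ d'.v₁} {a₂ : e ≫ d.v₂ ⟶ e' ≫ d'.v₂} {b : e ≫ H.k ⟶ e' ≫ H'.k}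
    (hσ₁ : Compatible H.σ₁.hom H'.σ₁.hom a₁ b) (hσ₂ : Compatible H.σ₂.hom H'.σ₂.hom a₂ b) :
    Compatible d.β d'.β a₁ a₂ := by
  have hβ := (hσ₁.postwhisker g₁.f).comp
    ((Compatible.whiskerLeft b r.β).comp
      (Compatible.inv (m := postwhiskerIso H.σ₂ g₂.f) (m' := postwhiskerIso H'.σ₂ g₂.f)
        (hσ₂.postwhisker g₂.f)))
  have eq_comp (d : FracRep (cC.comp f g₁) (cC.comp f g₂)) (H : Whiskering cC f r d) :
      d.β = postwhisker H.σ₁.hom g₁.f ≫ H.k ◁ r.β ≫ (postwhiskerIso H.σ₂ g₂.f).inv := by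
    rw [← Category.assoc]
    exact (Iso.eq_comp_inv _).2 H.β_comm.w
  rwa [eq_comp d H, eq_comp d' H']

theorem exists_compatible_φ_postwhisker_σ₁ (H : Whiskering cC f r d) (H' : Whiskering cC f r d') :
    ∃ (E : C) (e : E ⟶ d.apex) (e' : E ⟶ d'.apex) (a₁ : e ≫ d.v₁ ≅ e' ≫ d'.v₁)
      (a₂ : e ≫ d.v₂ ≅ e' ≫ d'.v₂) (b : e ≫ H.k ≅ e' ≫ H'.k), W e ∧
      Compatible H.φ.hom H'.φ.hom a₁.hom a₂.hom ∧
      Compatible (postwhisker H.σ₁.hom g₁.w) (postwhisker H'.σ₁.hom g₁.w) a₁.hom b.hom := by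
  obtain ⟨E, e, e', he, ⟨a₁⟩⟩ := exists_square (cC.comp f g₁).mem (q := d.v₁) d'.mem
  obtain ⟨F, v, a₂, hv, hφ⟩ := exists_compatible (cC.fill f.f g₂.w g₂.mem).mem H.φ H'.φ a₁
  obtain ⟨G, u, b, hu, hσ₁⟩ := exists_compatible r.mem (postwhiskerIso H.σ₁ g₁.w)
    (postwhiskerIso H'.σ₁ g₁.w) (prewhiskerIso v a₁)
  exact ⟨G, u ≫ v ≫ e, u ≫ v ≫ e', prewhiskerIso u (prewhiskerIso v a₁), prewhiskerIso u a₂, b,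
    AdmitsBicalculus.bf2 _ _ hu (AdmitsBicalculus.bf2 _ _ hv he), hφ.prewhisker u, hσ₁⟩

theorem rel_of_same_representative (H : Whiskering cC f r d) (H' : Whiskering cC f r d') :
    d.Rel d' := by
  obtain ⟨E, e, e', a₁, a₂, b, he, hφ, hσ₁⟩ := H.exists_compatible_φ_postwhisker_σ₁ H'
  have hσ₂ := H.compatible_postwhisker_σ₂ H' hφ hσ₁
  obtain ⟨F, v, hv, hσ₁⟩ := exists_compatible_of_postwhisker g₁.mem hσ₁
  obtain ⟨G, u, hu, hσ₂⟩ := exists_compatible_of_postwhisker g₂.mem (hσ₂.prewhisker v)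
  have huve : W (u ≫ v ≫ e) :=
    AdmitsBicalculus.bf2 _ _ hu (AdmitsBicalculus.bf2 _ _ hv he)
  exact FracRep.rel_of_compatible (AdmitsBicalculus.bf2 _ _ huve d.mem)
    (prewhiskerIso u (prewhiskerIso v a₁)) (prewhiskerIso u (prewhiskerIso v a₂))
    (H.compatible_α H' ((hφ.prewhisker v).prewhisker u))
    (H.compatible_β H' (hσ₁.prewhisker u) hσ₂)

/-- A comparison with `r` yields one with an equivalent `r'`, at the cost of restricting `d`. -/
def restrict (H : Whiskering cC f r d) {E F : C} {z : E ⟶ r.apex} {z' : E ⟶ r'.apex}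
    {a₁ : z ≫ r.v₁ ≅ z' ≫ r'.v₁} {a₂ : z ≫ r.v₂ ≅ z' ≫ r'.v₂}
    (hα : Compatible r.α.hom r'.α.hom a₁.hom a₂.hom)
    (hβ : Compatible r.β r'.β a₁.hom a₂.hom) {e : F ⟶ d.apex} (he : W e) {l : F ⟶ E}
    (κ : e ≫ H.k ≅ l ≫ z) : Whiskering cC f r' (d.restrict e he) where
  k := l ≫ z'
  σ₁ := prewhiskerIso e H.σ₁ ≪≫ whiskerRightIso κ r.v₁ ≪≫ prewhiskerIso l a₁
  σ₂ := prewhiskerIso e H.σ₂ ≪≫ whiskerRightIso κ r.v₂ ≪≫ prewhiskerIso l a₂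
  φ := prewhiskerIso e H.φ
  comm := (squarePasting_prewhiskerIso_hom _ _ e H.φ).symm ▸ commSq_restrict H.comm hα κ.hom
  α_eq := (congrArg (prewhisker e) H.α_eq).trans (postwhisker_prewhisker e H.φ.hom f.w).symm
  β_comm := commSq_restrict H.β_comm hβ κ.hom

theorem rel (H : Whiskering cC f r d) (hr : r.Rel r') (H' : Whiskering cC f r' d') :
    d.Rel d' := by
  obtain ⟨E, z, z', a₁, a₂, hz, hα, hβ⟩ := hr.exists_compatible
  obtain ⟨F, e, l, he, ⟨κ⟩⟩ := exists_square r.mem (q := H.k) hz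
  exact FracRep.rel_trans (d.rel_restrict e he)
    ((H.restrict hα hβ he κ).rel_of_same_representative H')

end Whiskering

end Whiskering

section Pasting

variable {C : Type u} [Bicategory.{w, v} C]
  {A A' B B₁ B₂ B₃ D₁ D₂ D₃ D₄ D₅ Z : C} {f : A' ⟶ B} {v₁ : B₁ ⟶ B} {v₂ : B₂ ⟶ B}
  {g₁ : B₁ ⟶ Z} {g₂ : B₂ ⟶ Z} {u₁ : B₃ ⟶ B₁} {u₂ : B₃ ⟶ B₂} {w₁ : D₁ ⟶ A'} {w₂ : D₂ ⟶ A'}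
  {f₁ : D₁ ⟶ B₁} {f₂ : D₂ ⟶ B₂} {t₁ : D₃ ⟶ D₁} {t₂ : D₄ ⟶ D₂} {h₁ : D₃ ⟶ B₃} {h₂ : D₄ ⟶ B₃}
  {t₃ : D₅ ⟶ D₃} {t₄ : D₅ ⟶ D₄}

theorem postcomp_hom (p : A' ⟶ A) (φ : t₃ ≫ t₁ ≫ w₁ ≅ t₄ ≫ t₂ ≫ w₂) :
    (postcomp p φ).hom =
      postwhisker ((α_ t₃ t₁ w₁).hom ≫ φ.hom ≫ (α_ t₄ t₂ w₂).inv) p := by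
  simp only [postcomp, postwhisker, bicategoricalIsoComp, Iso.trans_hom, Iso.refl_hom,
    whiskerRightIso_hom]
  bicategory

theorem zigzag_eq_hom (ρ₁ : w₁ ≫ f ≅ f₁ ≫ v₁) (ρ₂ : w₂ ≫ f ≅ f₂ ≫ v₂) (α : u₁ ≫ v₁ ≅ u₂ ≫ v₂)
    (σ₁ : t₁ ≫ f₁ ≅ h₁ ≫ u₁) (σ₂ : t₂ ≫ f₂ ≅ h₂ ≫ u₂)
    (φ : t₃ ≫ t₁ ≫ w₁ ≅ t₄ ≫ t₂ ≫ w₂) :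
    zigzag ρ₁ ρ₂ α σ₁ σ₂ φ =
      ((postwhiskerIso (prewhiskerIso t₃ σ₁) v₁).symm ≪≫
        squarePasting ρ₁ ρ₂ (α_ t₃ t₁ w₁ ≪≫ φ ≪≫ (α_ t₄ t₂ w₂).symm) ≪≫
        postwhiskerIso (prewhiskerIso t₄ σ₂) v₂ ≪≫ (whiskerLeftIso (t₄ ≫ h₂) α).symm).hom := by
  simp only [zigzag, squarePasting, postwhisker, prewhisker, Iso.trans_hom, Iso.symm_hom,
    postwhiskerIso_hom, postwhiskerIso_inv, prewhiskerIso_hom, prewhiskerIso_inv,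
    whiskerLeftIso_hom, whiskerLeftIso_inv]
  bicategory

theorem xi_eq (σ₁ : t₁ ≫ f₁ ≅ h₁ ≫ u₁) (σ₂ : t₂ ≫ f₂ ≅ h₂ ≫ u₂) (δ : t₃ ≫ h₁ ⟶ t₄ ≫ h₂)
    (β : u₁ ≫ g₁ ⟶ u₂ ≫ g₂) :
    xi σ₁ σ₂ δ β = postwhisker (prewhisker t₃ σ₁.hom ≫ δ ▷ u₁) g₁ ≫ (t₄ ≫ h₂) ◁ β ≫
      (postwhiskerIso (prewhiskerIso t₄ σ₂) g₂).inv := by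
  simp only [xi, postwhisker, prewhisker, postwhiskerIso_inv, prewhiskerIso_inv]
  bicategory

instance isIso_zigzag (ρ₁ : w₁ ≫ f ≅ f₁ ≫ v₁) (ρ₂ : w₂ ≫ f ≅ f₂ ≫ v₂) (α : u₁ ≫ v₁ ≅ u₂ ≫ v₂)
    (σ₁ : t₁ ≫ f₁ ≅ h₁ ≫ u₁) (σ₂ : t₂ ≫ f₂ ≅ h₂ ≫ u₂) (φ : t₃ ≫ t₁ ≫ w₁ ≅ t₄ ≫ t₂ ≫ w₂) :
    IsIso (zigzag ρ₁ ρ₂ α σ₁ σ₂ φ) := by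
  rw [zigzag_eq_hom]
  infer_instance

theorem zigzag_prewhiskerIso {D₆ : C} (c : D₆ ⟶ D₅) (ρ₁ : w₁ ≫ f ≅ f₁ ≫ v₁)
    (ρ₂ : w₂ ≫ f ≅ f₂ ≫ v₂) (α : u₁ ≫ v₁ ≅ u₂ ≫ v₂) (σ₁ : t₁ ≫ f₁ ≅ h₁ ≫ u₁)
    (σ₂ : t₂ ≫ f₂ ≅ h₂ ≫ u₂) (φ : t₃ ≫ t₁ ≫ w₁ ≅ t₄ ≫ t₂ ≫ w₂) :
    zigzag ρ₁ ρ₂ α σ₁ σ₂ (prewhiskerIso c φ) =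
      (α_ c t₃ h₁).hom ▷ (u₁ ≫ v₁) ≫ prewhisker c (zigzag ρ₁ ρ₂ α σ₁ σ₂ φ) ≫
        (α_ c t₄ h₂).inv ▷ (u₁ ≫ v₁) := by
  simp only [zigzag, prewhisker, prewhiskerIso_hom]
  bicategory

theorem commSq_zigzag (ρ₁ : w₁ ≫ f ≅ f₁ ≫ v₁) (ρ₂ : w₂ ≫ f ≅ f₂ ≫ v₂)
    {α : u₁ ≫ v₁ ≅ u₂ ≫ v₂} {σ₁ : t₁ ≫ f₁ ≅ h₁ ≫ u₁} {σ₂ : t₂ ≫ f₂ ≅ h₂ ≫ u₂}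
    {φ : t₃ ≫ t₁ ≫ w₁ ≅ t₄ ≫ t₂ ≫ w₂} {δ : t₃ ≫ h₁ ⟶ t₄ ≫ h₂}
    (h : δ ▷ (u₁ ≫ v₁) = zigzag ρ₁ ρ₂ α σ₁ σ₂ φ) :
    CommSq (squarePasting ρ₁ ρ₂ (α_ t₃ t₁ w₁ ≪≫ φ ≪≫ (α_ t₄ t₂ w₂).symm)).hom
      (postwhisker (prewhisker t₃ σ₁.hom ≫ δ ▷ u₁) v₁) (postwhisker (prewhisker t₄ σ₂.hom) v₂)
      ((t₄ ≫ h₂) ◁ α.hom) := by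
  refine ⟨?_⟩
  rw [postwhisker_comp, postwhisker_whiskerRight, h, zigzag_eq_hom]
  simp [← postwhiskerIso_hom, ← prewhiskerIso_hom, -postwhiskerIso_inv]

theorem commSq_xi (σ₁ : t₁ ≫ f₁ ≅ h₁ ≫ u₁) (σ₂ : t₂ ≫ f₂ ≅ h₂ ≫ u₂) (δ : t₃ ≫ h₁ ⟶ t₄ ≫ h₂)
    (β : u₁ ≫ g₁ ⟶ u₂ ≫ g₂) :
    CommSq (xi σ₁ σ₂ δ β) (postwhisker (prewhisker t₃ σ₁.hom ≫ δ ▷ u₁) g₁)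
      (postwhisker (prewhisker t₄ σ₂.hom) g₂) ((t₄ ≫ h₂) ◁ β) :=
  ⟨by simp [xi_eq, ← postwhiskerIso_hom, ← prewhiskerIso_hom, -postwhiskerIso_inv]⟩

end Pasting

section Diagrams

variable {C : Type u} [Bicategory.{w, v} C] {W : MorphismProperty C} [AdmitsBicalculus W]
  {cC : ChoicesC W} {A B Z : C} {f : FracMor W A B} {g₁ g₂ : FracMor W B Z}

/-- The diagram `(D⁵, t¹ ∘ t³, t² ∘ t⁴, w ∘ φ, ξ)` represents `[r] ∘ f`, by means of the morphism
`h² ∘ t⁴` to `r`. -/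
def Whiskering.ofPasting {r : FracRep g₁ g₂} {D₃ D₄ D₅ : C}
    {t₁ : D₃ ⟶ (cC.fill f.f g₁.w g₁.mem).apex} {t₂ : D₄ ⟶ (cC.fill f.f g₂.w g₂.mem).apex}
    {h₁ : D₃ ⟶ r.apex} {h₂ : D₄ ⟶ r.apex} {t₃ : D₅ ⟶ D₃} {t₄ : D₅ ⟶ D₄}
    (hW : W ((t₃ ≫ t₁) ≫ (cC.comp f g₁).w))
    (σ₁ : t₁ ≫ (cC.fill f.f g₁.w g₁.mem).f' ≅ h₁ ≫ r.v₁)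
    (σ₂ : t₂ ≫ (cC.fill f.f g₂.w g₂.mem).f' ≅ h₂ ≫ r.v₂)
    (φ : t₃ ≫ t₁ ≫ (cC.fill f.f g₁.w g₁.mem).v' ≅ t₄ ≫ t₂ ≫ (cC.fill f.f g₂.w g₂.mem).v')
    (δ : t₃ ≫ h₁ ≅ t₄ ≫ h₂)
    (hδ : δ.hom ▷ (r.v₁ ≫ g₁.w) = zigzag (cC.fill f.f g₁.w g₁.mem).ρ
      (cC.fill f.f g₂.w g₂.mem).ρ r.α σ₁ σ₂ φ) :
    Whiskering cC f r
      ⟨D₅, t₃ ≫ t₁, t₄ ≫ t₂, hW, postcomp f.w φ, xi σ₁ σ₂ δ.hom r.β⟩ where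
  k := t₄ ≫ h₂
  σ₁ := prewhiskerIso t₃ σ₁ ≪≫ whiskerRightIso δ r.v₁
  σ₂ := prewhiskerIso t₄ σ₂
  φ := α_ _ _ _ ≪≫ φ ≪≫ (α_ _ _ _).symm
  comm := commSq_zigzag _ _ hδ
  α_eq := postcomp_hom f.w φ
  β_comm := commSq_xi σ₁ σ₂ δ.hom r.β

/-- The diagram induced by auxiliary data (F5)–(F7) for `r` represents `[r] ∘ f`. -/
def WhiskerData.whiskering {r : FracRep g₁ g₂} (F : WhiskerData cC f r) :
    Whiskering cC f r F.diagram :=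
  Whiskering.ofPasting F.diagram.mem F.S₁.ρ F.S₂.ρ F.S₃.ρ F.δ F.eq

/-- The diagram obtained from squares `P₁`, `P₂`, `Q` and from a lift `K` of their pasting along a
morphism of `W` represents `[r] ∘ f`. -/
noncomputable def Whiskering.ofLift {r : FracRep g₁ g₂}
    (P₁ : Leg W (cC.fill f.f g₁.w g₁.mem).v' (cC.fill f.f g₁.w g₁.mem).f' r.v₁)
    (P₂ : Leg W (cC.fill f.f g₂.w g₂.mem).v' (cC.fill f.f g₂.w g₂.mem).f' r.v₂)
    (Q : Filler W (P₁.t ≫ (cC.fill f.f g₁.w g₁.mem).v') (P₂.t ≫ (cC.fill f.f g₂.w g₂.mem).v'))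
    (K : Lift W (r.v₁ ≫ g₁.w) (Q.v' ≫ P₁.h) (Q.f' ≫ P₂.h)
      (zigzag (cC.fill f.f g₁.w g₁.mem).ρ (cC.fill f.f g₂.w g₂.mem).ρ r.α P₁.σ P₂.σ Q.ρ))
    (hK : IsIso K.β) (hW : W (((K.v ≫ Q.v') ≫ P₁.t) ≫ (cC.comp f g₁).w)) :
    Whiskering cC f r ⟨K.apex, (K.v ≫ Q.v') ≫ P₁.t, (K.v ≫ Q.f') ≫ P₂.t, hW,
      postcomp f.w (prewhiskerIso K.v Q.ρ),
      xi P₁.σ P₂.σ (α_ _ _ _ ≪≫ asIso K.β ≪≫ (α_ _ _ _).symm).hom r.β⟩ :=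
  Whiskering.ofPasting hW P₁.σ P₂.σ (prewhiskerIso K.v Q.ρ)
    (α_ _ _ _ ≪≫ asIso K.β ≪≫ (α_ _ _ _).symm) (by
      rw [zigzag_prewhiskerIso, K.prewhisker_eq]
      simp)

variable (cC f) in
/-- Pronk's diagram constructed from `r` represents `[r] ∘ f`. -/
noncomputable def pronkWhiskering (cD : ChoicesD W) (r : FracRep g₁ g₂) :
    Whiskering cC f r (pronkRep cC cD f r) :=
  Whiskering.ofLift (pronkLeg cC cD f g₁ r.v₁ r.mem) (pronkLeg cC cD f g₂ r.v₂ r.mem₂)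
    (cC.fill _ _ (pronkLeg cC cD f g₂ r.v₂ r.mem₂).mem) (cD.lift _ r.mem _ _ _)
    (cD.isIso _ _ _ _ _ inferInstance) (pronkRep cC cD f r).mem

end Diagrams

end BicategoryOfFractions

theorem mainTheorem5 {C : Type u} [Bicategory.{w, v} C]
    (W : MorphismProperty C) [AdmitsBicalculus W] (cC : ChoicesC W) {A B Z : C}
    (f : FracMor W A B) {g₁ g₂ : FracMor W B Z} (Γ : TwoMor g₁ g₂) :
    -- `Γ ∘ f` is well defined: it may be computed from any representative of `Γ`
    (∀ (cD : ChoicesD W) (r : FracRep g₁ g₂), r.Represents Γ →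
      (pronkRep cC cD f r).Represents (compLeft cC cD f Γ)) ∧
    -- any representative of `Γ` and any auxiliary data give a diagram representing `Γ ∘ f`
    (∀ (cD : ChoicesD W) (r : FracRep g₁ g₂), r.Represents Γ →
      ∀ F : WhiskerData cC f r, F.diagram.Represents (compLeft cC cD f Γ)) ∧
    -- the diagrams obtained from two sets of such choices represent the same 2-morphism
    (∀ r r' : FracRep g₁ g₂, r.Represents Γ → r'.Represents Γ →
      ∀ (F : WhiskerData cC f r) (F' : WhiskerData cC f r'), F.diagram.Rel F'.diagram) ∧
    -- `Γ ∘ f` does not depend on the choices `D(W)`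
    (∀ cD cD' : ChoicesD W, compLeft cC cD f Γ = compLeft cC cD' f Γ) := by
  have represents (cD : ChoicesD W) (r : FracRep g₁ g₂) (hr : r.Represents Γ)
      (d : FracRep (cC.comp f g₁) (cC.comp f g₂)) (H : Whiskering cC f r d) :
      d.Represents (compLeft cC cD f Γ) :=
    Quotient.sound (H.rel (Quotient.exact (hr.trans Γ.out_eq.symm))
      (pronkWhiskering cC f cD Γ.out))
  exact ⟨fun cD r hr => represents cD r hr _ (pronkWhiskering cC f cD r),
    fun cD r hr F => represents cD r hr _ F.whiskering,
    fun r r' hr hr' F F' => F.whiskering.rel (Quotient.exact (hr.trans hr'.symm)) F'.whiskering,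
    fun cD cD' => represents cD' Γ.out Γ.out_eq _ (pronkWhiskering cC f cD Γ.out)⟩
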